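/- Let $(X,d)$ be a compact metric space, $P(X)$ the set of its Borel probability measures, and $$W_1(\mu,\xi)=\inf_{\pi}\int d(x_1,x_2)\,d\pi(x_1,x_2),$$ the infimum being over the probability measures $\pi$ on $X\times X$ with marginals $\mu$ and $\xi$. Let $\phi:\mathbb R\to[-\infty,\infty]$ be proper (never $-\infty$, not identically $\infty$), convex and lower semicontinuous, and for $\mu,\nu\in P(X)$ let $$D_\phi(\mu\Vert\nu)=\int \phi\circ\frac{d\mu_c}{d\nu}\,d\nu+\phi'(\infty)\,\mu_s(X)\in(-\infty,\infty],\qquad \phi'(\infty)=\lim_{x\to\infty}\frac{\phi(x)}{x},$$ where $\mu=\mu_c+\mu_s$ with $\mu_c\ll\nu$, $\mu_s\perp\nu$ is the Lebesgue decomposition of $\mu$ with respect to $\nu$, and $0\cdot\infty=0$. For real $\lambda,\alpha>0$ define $$D_{\phi,\lambda,\alpha}(\mu\Vert\nu)=\inf_{\xi\in P(X)}\left\{D_\phi(\xi\Vert\nu)+\lambda W_1(\mu,\xi)^\alpha\right\}.$$ Then for every $\nu\in P(X)$ and every real $\alpha>0$: 1. For all $\mu\in P(X)$ and $\lambda>0$,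 the infimum defining $D_{\phi,\lambda,\alpha}(\mu\Vert\nu)$ is attained by some $\xi\in P(X)$. 2. For all $\mu\in P(X)$, $D_\phi(\mu\Vert\nu)=\sup_{\lambda>0}D_{\phi,\lambda,\alpha}(\mu\Vert\nu)=\lim_{\lambda\to\infty}D_{\phi,\lambda,\alpha}(\mu\Vert\nu)$. 3. Suppose in addition that $\phi(1)<\infty$ (in particular this holds if $\phi(1)=0$). Then for every $\lambda>0$ the function $F=D_{\phi,\lambda,\alpha}(\cdot\Vert\nu)$ is real-valued on $P(X)$, and: - if $\alpha<1$, then $|F(\mu_1)-F(\mu_2)|\le\lambda W_1(\mu_1,\mu_2)^\alpha$ for all $\mu_1,\mu_2\in P(X)$; - if $\alpha=1$, then $|F(\mu_1)-F(\mu_2)|\le\lambda W_1(\mu_1,\mu_2)$ for all $\mu_1,\mu_2\in P(X)$; - if $\alpha>1$, then there is a constant $C\ge 0$ with $|F(\mu_1)-F(\mu_2)|\le C\,W_1(\mu_1,\mu_2)$ for all $\mu_1,\mu_2\in P(X)$. -/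

import Mathlib

open MeasureTheory Filter Topology

noncomputable section

/-- A function `φ : ℝ → [-∞, ∞]` is proper if it is not identically `∞` and never takes the
value `-∞`. -/
def IsProperFn (φ : ℝ → EReal) : Prop :=
  (∃ x, φ x < ⊤) ∧ ∀ x, ⊥ < φ x

/-- Convexity of an extended-real-valued function on `ℝ` (with the convention `0 * ∞ = 0`, and used
for functions that never take the value `-∞`). -/
def IsConvexFn (φ : ℝ → EReal) : Prop :=
  ∀ x y a b : ℝ, 0 ≤ a → 0 ≤ b → a + b = 1 →
    φ (a * x + b * y) ≤ (a : EReal) * φ x + (b : EReal) * φ y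

/-- The slope at infinity `φ'(∞) = lim_{x → ∞} φ(x) / x`, an extended real number. For proper convex
`φ` the limit exists, so it equals the lower limit used here. -/
def slopeAtTop (φ : ℝ → EReal) : EReal :=
  liminf (fun x : ℝ => φ x / (x : EReal)) atTop

/-- The integral `∫ g dν ∈ [-∞, ∞]` of an extended-real-valued function: the integral of the
positive part minus the integral of the negative part. -/
def erealIntegral {X : Type*} [MeasurableSpace X] (ν : Measure X) (g : X → EReal) : EReal :=
  ((∫⁻ x, (g x).toENNReal ∂ν : ENNReal) : EReal) - ((∫⁻ x, (-g x).toENNReal ∂ν : ENNReal) : EReal)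

/-- The `f`-divergence `D_φ(μ ‖ ν) = ∫ φ ∘ (dμ_c / dν) dν + φ'(∞) μ_s(X)`, where `μ = μ_c + μ_s` is
the Lebesgue decomposition of `μ` with respect to `ν`. Since `μ` is a nonnegative measure, the
negative part of `μ_s` vanishes. -/
def fDivergence {X : Type*} [MeasurableSpace X] (φ : ℝ → EReal) (μ ν : ProbabilityMeasure X) :
    EReal :=
  erealIntegral (ν : Measure X)
      (fun x => φ (((μ : Measure X).rnDeriv (ν : Measure X) x).toReal)) +
    slopeAtTop φ * (((μ : Measure X).singularPart (ν : Measure X) Set.univ : ENNReal) : EReal)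

/-- The couplings of `μ` and `ν`: the probability measures on `X × X` with marginals `μ`, `ν`. -/
def couplings {X : Type*} [MeasurableSpace X] (μ ν : ProbabilityMeasure X) :
    Set (ProbabilityMeasure (X × X)) :=
  {π | (π : Measure (X × X)).map Prod.fst = (μ : Measure X) ∧
    (π : Measure (X × X)).map Prod.snd = (ν : Measure X)}

/-- The Wasserstein-1 distance of two probability measures. (On a compact space the distance is
bounded, so every integral here is finite.) -/
def wasserstein1 {X : Type*} [MetricSpace X] [MeasurableSpace X] (μ ν : ProbabilityMeasure X) : ℝ :=
  ⨅ π : couplings μ ν, ∫ z, dist z.1 z.2 ∂(π.1 : Measure (X × X))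

/-- The quantity `D_φ(ξ ‖ ν) + l * W₁(μ, ξ) ^ α` that is minimized over `ξ`. -/
def moreauYosidaObjective {X : Type*} [MetricSpace X] [MeasurableSpace X] (φ : ℝ → EReal)
    (l α : ℝ) (μ ν ξ : ProbabilityMeasure X) : EReal :=
  fDivergence φ ξ ν + ((l * wasserstein1 μ ξ ^ α : ℝ) : EReal)

/-- The Moreau-Yosida approximation `D_{φ,l,α}(μ ‖ ν)` of index `l` and order `α` of `D_φ(· ‖ ν)`
with respect to `W₁`. -/
def moreauYosidaDivergence {X : Type*} [MetricSpace X] [MeasurableSpace X] (φ : ℝ → EReal)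
    (l α : ℝ) (μ ν : ProbabilityMeasure X) : EReal :=
  ⨅ ξ : ProbabilityMeasure X, moreauYosidaObjective φ l α μ ν ξ

/-- `F` is finite everywhere and Hölder continuous with respect to `W₁` with exponent `r` and
constant `C` (for `r = 1`: Lipschitz continuous with constant `C`). -/
def IsHolderW1 {X : Type*} [MetricSpace X] [MeasurableSpace X] (C r : ℝ)
    (F : ProbabilityMeasure X → EReal) : Prop :=
  (∀ μ, F μ ≠ ⊤ ∧ F μ ≠ ⊥) ∧
    ∀ μ₁ μ₂, |(F μ₁).toReal - (F μ₂).toReal| ≤ C * wasserstein1 μ₁ μ₂ ^ r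

end

/-! Everything rests on a dual formula. Let `K` be the set of affine minorants `t ↦ a + b * t` of
`φ`. Then `D_φ(ξ ‖ ν)` is the supremum of `∫ u dν + ∫ v dξ` over continuous maps `(u, v) : X → K`.
The bound `≥` (`dualObjective_le_fDivergence`) integrates the minorants along the Lebesgue
decomposition of `ξ`. For `≤` (`exists_dualObjective_gt_of_lt_fDivergence`), `φ` is the supremum of
its affine minorants and `φ'(∞)` the supremum of their slopes. Maximizing over finitely many
minorants from a dense sequence, at the density or by slope on a `ν`-null set carrying the singular
part, gives a measurable selection. Since `K` is convex, this selection is a bounded almost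
everywhere limit of continuous maps into `K`.

Each dual functional is weakly continuous in `ξ`, so `D_φ(· ‖ ν)` is weakly lower semicontinuous;
constant maps bound it below. Attainment follows by compactness, minimizing over plans with first
marginal `μ`, where the transport cost is continuous.

The dual functionals are also Lipschitz for `W₁` up to small errors. Hence `D_φ(ξ ‖ ν) > c` persists
for `ξ` in a `W₁`-ball around `μ`, while outside it a large `λ` makes the penalty exceed the lower
bound's deficit; this gives the limit and the supremum.

For the Hölder bounds, the minimizer for `μ₂` is a competitor for `μ₁`. The triangle inequality,
proved by gluing, reduces the claim to scalar estimates for `t ^ α` on `[0, diam X]`. -/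

/-! ### Affine minorants and slope at infinity -/

/-- The pairs `(a, b)` for which the affine function `t ↦ a + b * t` is a minorant of `φ`. -/
def affineMinorants (φ : ℝ → EReal) : Set (ℝ × ℝ) :=
  {p | ∀ t : ℝ, ((p.1 + p.2 * t : ℝ) : EReal) ≤ φ t}

/-- Convexity is what allows discontinuous selections of minorants to be blended into continuous
ones. -/
lemma convex_affineMinorants (φ : ℝ → EReal) : Convex ℝ (affineMinorants φ) := by
  intro p hp q hq a b ha hb hab t
  have h1 := hp t
  have h2 := hq t
  induction h : φ t with
  | top => exact le_top
  | bot => exact absurd (le_bot_iff.1 (h ▸ h1)) (EReal.coe_ne_bot _)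
  | coe r =>
    rw [h, EReal.coe_le_coe_iff] at h1 h2
    rw [EReal.coe_le_coe_iff]
    simp only [Prod.fst_add, Prod.smul_fst, Prod.snd_add, Prod.smul_snd, smul_eq_mul]
    have h3 : a * r + b * r = r := by rw [← add_mul, hab, one_mul]
    nlinarith [mul_le_mul_of_nonneg_left h1 ha, mul_le_mul_of_nonneg_left h2 hb]

lemma IsConvexFn.convex_epigraph {φ : ℝ → EReal} (hφ : IsConvexFn φ) :
    Convex ℝ {p : ℝ × ℝ | φ p.1 ≤ (p.2 : EReal)} := by
  intro p hp q hq a b ha hb hab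
  have h := hφ p.1 q.1 a b ha hb hab
  refine h.trans ?_
  have h1 : (a : EReal) * φ p.1 ≤ (a : EReal) * (p.2 : EReal) :=
    mul_le_mul_of_nonneg_left hp (by exact_mod_cast ha)
  have h2 : (b : EReal) * φ q.1 ≤ (b : EReal) * (q.2 : EReal) :=
    mul_le_mul_of_nonneg_left hq (by exact_mod_cast hb)
  refine (add_le_add h1 h2).trans (le_of_eq ?_)
  simp [EReal.coe_add, EReal.coe_mul]

/-- A line separating a point strictly below the graph of a convex lower semicontinuous function
from its epigraph. -/
lemma exists_separating_line {φ : ℝ → EReal} (hφ_proper : IsProperFn φ) (hφ_convex : IsConvexFn φ)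
    (hφ_lsc : LowerSemicontinuous φ) {t c : ℝ} (hc : (c : EReal) < φ t) :
    ∃ p q u : ℝ, 0 ≤ q ∧ p * t + q * c < u ∧
      ∀ x y : ℝ, φ x ≤ (y : EReal) → u < p * x + q * y := by
  have hclosed : IsClosed {p : ℝ × ℝ | φ p.1 ≤ (p.2 : EReal)} :=
    hφ_lsc.isClosed_epigraph.preimage
      (continuous_fst.prodMk (continuous_coe_real_ereal.comp continuous_snd))
  obtain ⟨f, u, hu, hf⟩ := geometric_hahn_banach_point_closed hφ_convex.convex_epigraph hclosed
    (show (t, c) ∉ {p : ℝ × ℝ | φ p.1 ≤ (p.2 : EReal)} from not_le.2 hc)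
  have hlin : ∀ x y : ℝ, f (x, y) = f (1, 0) * x + f (0, 1) * y := by
    intro x y
    have : ((x, y) : ℝ × ℝ) = x • (1, 0) + y • (0, 1) := by ext <;> simp
    rw [this, map_add, map_smul, map_smul]
    simp [mul_comm]
  refine ⟨f (1, 0), f (0, 1), u, ?_, by rw [← hlin]; exact hu, fun x y h => by
    rw [← hlin]; exact hf _ h⟩
  obtain ⟨⟨x0, hx0⟩, -⟩ := hφ_proper
  obtain ⟨y0, hy0, -⟩ := EReal.lt_iff_exists_real_btwn.1 hx0
  -- The epigraph is unbounded upwards, so a negative `q` would push a point of it across the line.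
  by_contra! hq
  set q := f (0, 1)
  set p := f (1, 0)
  have h := hf (x0, max y0 ((u - p * x0) / q))
    (show φ x0 ≤ ((max y0 ((u - p * x0) / q) : ℝ) : EReal) from
      hy0.le.trans (by exact_mod_cast le_max_left _ _))
  rw [hlin] at h
  have h2 : q * max y0 ((u - p * x0) / q) ≤ q * ((u - p * x0) / q) :=
    mul_le_mul_of_nonpos_left (le_max_right _ _) hq.le
  rw [mul_div_cancel₀ _ hq.ne] at h2
  change u < p * x0 + q * _ at h
  linarith

lemma mem_affineMinorants_of_line {φ : ℝ → EReal} (hφ_bot : ∀ x, ⊥ < φ x) {p q u : ℝ} (hq : 0 < q)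
    (h : ∀ x y : ℝ, φ x ≤ (y : EReal) → u < p * x + q * y) :
    (u / q, -(p / q)) ∈ affineMinorants φ := by
  intro x
  induction hx : φ x with
  | top => exact le_top
  | bot => exact absurd hx (hφ_bot x).ne'
  | coe y =>
    have := h x y hx.le
    rw [EReal.coe_le_coe_iff]
    have h2 : u / q + -(p / q) * x = (u - p * x) / q := by field_simp; ring
    simp only [h2]
    rw [div_le_iff₀ hq]
    linarith

lemma affineMinorants_nonempty {φ : ℝ → EReal} (hφ_proper : IsProperFn φ)
    (hφ_convex : IsConvexFn φ) (hφ_lsc : LowerSemicontinuous φ) :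
    (affineMinorants φ).Nonempty := by
  obtain ⟨x0, hx0⟩ := hφ_proper.1
  obtain ⟨y0, hy0, -⟩ := EReal.lt_iff_exists_real_btwn.1 hx0
  obtain ⟨c, -, hc⟩ := EReal.lt_iff_exists_real_btwn.1 (hφ_proper.2 x0)
  obtain ⟨p, q, u, hq, h1, h2⟩ := exists_separating_line hφ_proper hφ_convex hφ_lsc hc
  rcases hq.eq_or_lt with rfl | hq
  -- A vertical line cannot separate here, since `φ x0` is finite.
  · have := h2 x0 y0 hy0.le
    linarith
  · exact ⟨_, mem_affineMinorants_of_line hφ_proper.2 hq h2⟩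

/-- A proper convex lower semicontinuous function is the supremum of its affine minorants. -/
lemma exists_affineMinorant_gt {φ : ℝ → EReal} (hφ_proper : IsProperFn φ)
    (hφ_convex : IsConvexFn φ) (hφ_lsc : LowerSemicontinuous φ) {t c : ℝ}
    (hc : (c : EReal) < φ t) : ∃ p ∈ affineMinorants φ, c < p.1 + p.2 * t := by
  obtain ⟨p, q, u, hq, h1, h2⟩ := exists_separating_line hφ_proper hφ_convex hφ_lsc hc
  rcases hq.eq_or_lt with rfl | hq
  -- The line is vertical: `u - p * x` is negative wherever `φ x` is finite and positive at `t`.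
  -- Adding a large multiple of it to any minorant keeps a minorant and raises the value at `t`
  -- beyond `c`.
  · obtain ⟨k, hk⟩ := affineMinorants_nonempty hφ_proper hφ_convex hφ_lsc
    have hpos : 0 < u - p * t := by linarith
    obtain ⟨n, hn⟩ := exists_nat_gt ((c - (k.1 + k.2 * t)) / (u - p * t))
    rw [div_lt_iff₀ hpos] at hn
    refine ⟨(k.1 + n * u, k.2 - n * p), fun x => ?_, by simp only; linarith⟩
    have hkx := hk x
    induction hx : φ x with
    | top => exact le_top
    | bot => exact absurd hx (hφ_proper.2 x).ne'
    | coe y =>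
      rw [hx, EReal.coe_le_coe_iff] at hkx
      rw [EReal.coe_le_coe_iff]
      have h3 := h2 x y hx.le
      have h4 : (n : ℝ) * (u - p * x) ≤ 0 :=
        mul_nonpos_of_nonneg_of_nonpos (Nat.cast_nonneg n) (by linarith)
      simp only
      linarith
  · refine ⟨_, mem_affineMinorants_of_line hφ_proper.2 hq h2, ?_⟩
    have h3 : u / q + -(p / q) * t = (u - p * t) / q := by field_simp; ring
    simp only [h3]
    rw [lt_div_iff₀ hq]
    linarith

lemma le_slopeAtTop {φ : ℝ → EReal} {p : ℝ × ℝ} (hp : p ∈ affineMinorants φ) :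
    (p.2 : EReal) ≤ slopeAtTop φ := by
  have h1 : Tendsto (fun x : ℝ => ((p.1 / x + p.2 : ℝ) : EReal)) atTop (𝓝 (p.2 : EReal)) := by
    refine (continuous_coe_real_ereal.tendsto _).comp ?_
    have := (tendsto_const_nhds (x := p.1)).div_atTop (tendsto_id (α := ℝ) (x := atTop))
    simpa using this.add_const p.2
  rw [← h1.liminf_eq, slopeAtTop]
  refine liminf_le_liminf ?_
  filter_upwards [eventually_gt_atTop (0 : ℝ)] with x hx
  rw [EReal.le_div_iff_mul_le (by exact_mod_cast hx) (EReal.coe_ne_top x), ← EReal.coe_mul]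
  refine le_trans (le_of_eq ?_) (hp x)
  congr 1
  field_simp

lemma exists_affineMinorant_slope_ge {φ : ℝ → EReal} (h0 : (affineMinorants φ).Nonempty) {c : ℝ}
    (hc : (c : EReal) < slopeAtTop φ) : ∃ p ∈ affineMinorants φ, c ≤ p.2 := by
  obtain ⟨k, hk⟩ := h0
  by_cases hkc : c ≤ k.2
  · exact ⟨k, hk, hkc⟩
  push Not at hkc
  obtain ⟨x0, hx0⟩ := eventually_atTop.1 (eventually_lt_of_lt_liminf hc)
  set x1 := max x0 1
  have hx1 : 0 < x1 := lt_max_of_lt_right one_pos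
  -- To the right of `x1`, `c * x ≤ φ x` and a nonpositive intercept suffices. To the left, the line
  -- of slope `c > k.2` meeting `k` at `x1` lies below `k`.
  refine ⟨(min 0 (k.1 + (k.2 - c) * x1), c), fun x => ?_, le_rfl⟩
  rcases le_total x1 x with h | h
  · have h1 := (hx0 x ((le_max_left _ _).trans h)).le
    have hx : 0 < x := hx1.trans_le h
    rw [EReal.le_div_iff_mul_le (by exact_mod_cast hx) (EReal.coe_ne_top x), ← EReal.coe_mul] at h1
    refine le_trans ?_ h1
    rw [EReal.coe_le_coe_iff]
    simp
  · refine le_trans ?_ (hk x)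
    rw [EReal.coe_le_coe_iff]
    have h2 : min 0 (k.1 + (k.2 - c) * x1) ≤ k.1 + (k.2 - c) * x1 := min_le_right _ _
    simp only
    nlinarith

/-! ### Extended-real integrals and suprema of sequences -/

lemma erealIntegral_mono {X : Type*} [MeasurableSpace X] {ν : Measure X} {g h : X → EReal}
    (hgh : ∀ x, g x ≤ h x) : erealIntegral ν g ≤ erealIntegral ν h := by
  refine EReal.sub_le_sub ?_ ?_
  · exact EReal.coe_ennreal_le_coe_ennreal_iff.2
      (lintegral_mono fun x => EReal.toENNReal_le_toENNReal (hgh x))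
  · exact EReal.coe_ennreal_le_coe_ennreal_iff.2
      (lintegral_mono fun x => EReal.toENNReal_le_toENNReal (EReal.neg_le_neg_iff.2 (hgh x)))

lemma erealIntegral_coe {X : Type*} [MeasurableSpace X] {ν : Measure X} {g : X → ℝ}
    (hg : Integrable g ν) : erealIntegral ν (fun x => (g x : EReal)) = ((∫ x, g x ∂ν : ℝ) : EReal) := by
  have h1 : ∫⁻ x, ENNReal.ofReal (g x) ∂ν ≠ ⊤ := hg.lintegral_lt_top.ne
  have h2 : ∫⁻ x, ENNReal.ofReal (-g x) ∂ν ≠ ⊤ := hg.neg.lintegral_lt_top.ne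
  rw [integral_eq_lintegral_pos_part_sub_lintegral_neg_part hg, erealIntegral, EReal.coe_sub,
    EReal.coe_ennreal_toReal h1, EReal.coe_ennreal_toReal h2]
  rfl

/-- Monotone convergence for extended-real-valued functions. -/
lemma tendsto_erealIntegral_of_monotone {X : Type*} [MeasurableSpace X] {ν : Measure X}
    {g : ℕ → X → EReal} {G : X → EReal} (hg : ∀ n, Measurable (g n))
    (hmono : ∀ x, Monotone fun n => g n x)
    (hlim : ∀ x, Tendsto (fun n => g n x) atTop (𝓝 (G x)))
    (h0 : ∫⁻ x, (-g 0 x).toENNReal ∂ν ≠ ⊤) :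
    Tendsto (fun n => erealIntegral ν (g n)) atTop (𝓝 (erealIntegral ν G)) := by
  have hpos := lintegral_tendsto_of_tendsto_of_monotone (μ := ν)
    (f := fun n x => (g n x).toENNReal) (F := fun x => (G x).toENNReal)
    (fun n => (hg n).ereal_toENNReal.aemeasurable)
    (ae_of_all _ fun x m n hmn => EReal.toENNReal_le_toENNReal (hmono x hmn))
    (ae_of_all _ fun x => (EReal.continuous_toENNReal.tendsto _).comp (hlim x))
  have hneg := lintegral_tendsto_of_tendsto_of_antitone (μ := ν)
    (f := fun n x => (-g n x).toENNReal) (F := fun x => (-G x).toENNReal)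
    (fun n => (hg n).neg.ereal_toENNReal.aemeasurable)
    (ae_of_all _ fun x m n hmn =>
      EReal.toENNReal_le_toENNReal (EReal.neg_le_neg_iff.2 (hmono x hmn))) h0
    (ae_of_all _ fun x => (EReal.continuous_toENNReal.tendsto _).comp
      ((continuous_neg.tendsto _).comp (hlim x)))
  have hfin : ∫⁻ x, (-G x).toENNReal ∂ν ≠ ⊤ := by
    refine ne_top_of_le_ne_top h0 (lintegral_mono fun x => EReal.toENNReal_le_toENNReal ?_)
    exact EReal.neg_le_neg_iff.2 ((hmono x).ge_of_tendsto (hlim x) 0)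
  have hpos' := (continuous_coe_ennreal_ereal.tendsto _).comp hpos
  have hneg' := (continuous_neg.tendsto _).comp ((continuous_coe_ennreal_ereal.tendsto _).comp hneg)
  simp only [erealIntegral, sub_eq_add_neg]
  -- Finiteness of the integral of the negative part excludes `∞ - ∞` in the limit.
  refine (EReal.continuousAt_add ?_ ?_).tendsto.comp (hpos'.prodMk_nhds hneg')
  · right
    simp [EReal.neg_eq_bot_iff, hfin]
  · left
    exact EReal.coe_ennreal_ne_bot _

lemma tendsto_partialSups_ereal {f : ℕ → ℝ} {L : EReal} (h1 : ∀ n, (f n : EReal) ≤ L)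
    (h2 : ∀ c : ℝ, (c : EReal) < L → ∃ n, c < f n) :
    Tendsto (fun n => ((partialSups f n : ℝ) : EReal)) atTop (𝓝 L) := by
  have hle : ∀ n, ((partialSups f n : ℝ) : EReal) ≤ L := by
    intro n
    obtain ⟨m, -, hm⟩ := exists_partialSups_eq f n
    rw [hm]
    exact h1 m
  rw [tendsto_order]
  refine ⟨fun c hc => ?_, fun c hc => Eventually.of_forall fun n => (hle n).trans_lt hc⟩
  obtain ⟨c', hcc', hc'⟩ := EReal.lt_iff_exists_real_btwn.1 hc
  obtain ⟨n, hn⟩ := h2 c' hc'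
  filter_upwards [eventually_ge_atTop n] with m hm
  refine hcc'.trans (EReal.coe_lt_coe_iff.2 (hn.trans_le ?_))
  exact le_partialSups_of_le f hm

/-! ### Approximation by continuous maps into a convex set -/

/-- A sequence of elements of `K` that is dense in `K`. -/
lemma exists_dense_seq_in {E : Type*} [TopologicalSpace E] [SecondCountableTopology E] {K : Set E}
    (hK : K.Nonempty) :
    ∃ k : ℕ → E, (∀ n, k n ∈ K) ∧ ∀ U : Set E, IsOpen U → (K ∩ U).Nonempty → ∃ n, k n ∈ U := by
  have := hK.to_subtype
  refine ⟨fun n => (TopologicalSpace.denseSeq K n : K), fun n => Subtype.coe_prop _, ?_⟩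
  rintro U hU ⟨x, hx, hxU⟩
  exact (TopologicalSpace.denseRange_denseSeq K).exists_mem_open
    (hU.preimage continuous_subtype_val) ⟨⟨x, hx⟩, hxU⟩

/-- Bounded continuous functions are dense in `L¹`; pass to an almost everywhere convergent
subsequence and truncate to `[0, 1]`. -/
lemma exists_continuous_seq_tendsto_indicator {X : Type*} [MetricSpace X]
    [MeasurableSpace X] [BorelSpace X] (σ : Measure X) [IsFiniteMeasure σ] {A : Set X}
    (hA : MeasurableSet A) :
    ∃ h : ℕ → C(X, ℝ), (∀ n x, h n x ∈ Set.Icc (0 : ℝ) 1) ∧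
      ∀ᵐ x ∂σ, Tendsto (fun n => h n x) atTop (𝓝 (A.indicator 1 x)) := by
  have hint : Integrable (A.indicator (1 : X → ℝ)) σ := (integrable_const 1).indicator hA
  choose g hg hgi using fun n : ℕ => hint.exists_boundedContinuous_lintegral_sub_le
    (ε := ((n : ENNReal) + 1)⁻¹) (by simp)
  have hmeas : TendstoInMeasure σ (fun n x => g n x) atTop (A.indicator (1 : X → ℝ)) := by
    refine tendstoInMeasure_of_tendsto_eLpNorm one_ne_zero
      (fun n => (hgi n).aestronglyMeasurable) hint.aestronglyMeasurable ?_
    refine tendsto_of_tendsto_of_tendsto_of_le_of_le tendsto_const_nhds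
      (ENNReal.tendsto_inv_nat_nhds_zero.comp (tendsto_add_atTop_nat 1)) (fun n => zero_le)
      fun n => ?_
    rw [eLpNorm_sub_comm, eLpNorm_one_eq_lintegral_enorm]
    simpa using hg n
  obtain ⟨ns, -, hns⟩ := hmeas.exists_seq_tendsto_ae
  refine ⟨fun n => ⟨fun x => max 0 (min 1 (g (ns n) x)), by fun_prop⟩, fun n x => ?_, ?_⟩
  · exact ⟨le_max_left _ _, max_le zero_le_one (min_le_left _ _)⟩
  · filter_upwards [hns] with x hx
    have hcont : Continuous fun y : ℝ => max 0 (min 1 y) := by fun_prop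
    have := (hcont.tendsto _).comp hx
    have heq : A.indicator (1 : X → ℝ) x = max 0 (min 1 (A.indicator 1 x)) := by
      by_cases hxA : x ∈ A <;> simp [hxA]
    rw [heq]
    exact this

/-- `g` is a bounded measurable function that is the almost everywhere limit of a uniformly bounded
sequence of continuous functions with values in `K`. -/
def IsBoundedContinuousLimit {X : Type*} [TopologicalSpace X] [MeasurableSpace X] (σ : Measure X)
    (K : Set (ℝ × ℝ)) (g : X → ℝ × ℝ) : Prop :=
  Measurable g ∧ ∃ C : ℝ, (∀ x, ‖g x‖ ≤ C) ∧ ∃ w : ℕ → C(X, ℝ × ℝ),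
    (∀ n x, w n x ∈ K) ∧ (∀ n x, ‖w n x‖ ≤ C) ∧
      ∀ᵐ x ∂σ, Tendsto (fun n => w n x) atTop (𝓝 (g x))

lemma isBoundedContinuousLimit_const {X : Type*} [TopologicalSpace X] [MeasurableSpace X]
    {σ : Measure X} {K : Set (ℝ × ℝ)} {p : ℝ × ℝ} (hp : p ∈ K) :
    IsBoundedContinuousLimit σ K fun _ : X => p :=
  ⟨measurable_const, ‖p‖, fun _ => le_rfl, fun _ => ContinuousMap.const X p, fun _ _ => hp,
    fun _ _ => le_rfl, ae_of_all _ fun _ => tendsto_const_nhds⟩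

-- With `h n` tending to the indicator of `A`, the convex combinations `h n • w n + (1 - h n) • w'
-- n` stay in `K` and converge to the piecewise map.
open scoped Classical in
lemma IsBoundedContinuousLimit.piecewise {X : Type*} [MetricSpace X] [MeasurableSpace X]
    [BorelSpace X] {σ : Measure X} [IsFiniteMeasure σ] {K : Set (ℝ × ℝ)} (hK : Convex ℝ K)
    {g g' : X → ℝ × ℝ} (hg : IsBoundedContinuousLimit σ K g)
    (hg' : IsBoundedContinuousLimit σ K g') {A : Set X} (hA : MeasurableSet A) :
    IsBoundedContinuousLimit σ K (A.piecewise g g') := by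
  obtain ⟨hgm, C, hgC, w, hwK, hwC, hw⟩ := hg
  obtain ⟨hgm', C', hgC', w', hwK', hwC', hw'⟩ := hg'
  obtain ⟨h, hh, hhA⟩ := exists_continuous_seq_tendsto_indicator σ hA
  refine ⟨hgm.piecewise hA hgm', max C C', fun x => ?_,
    fun n => ⟨fun x => h n x • w n x + (1 - h n x) • w' n x, by fun_prop⟩, fun n x => ?_,
    fun n x => ?_, ?_⟩
  · by_cases hx : x ∈ A
    · simpa [hx] using Or.inl (hgC x)
    · simpa [hx] using Or.inr (hgC' x)
  · exact hK (hwK n x) (hwK' n x) (hh n x).1 (sub_nonneg.2 (hh n x).2) (by ring)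
  · have hball : Convex ℝ (Metric.closedBall (0 : ℝ × ℝ) (max C C')) := convex_closedBall _ _
    have := hball (x := w n x) (by simpa using Or.inl (hwC n x)) (y := w' n x)
      (by simpa using Or.inr (hwC' n x)) (hh n x).1 (sub_nonneg.2 (hh n x).2) (by ring)
    exact mem_closedBall_zero_iff.1 this
  · filter_upwards [hw, hw', hhA] with x hx hx' hxA
    have := (hxA.smul hx).add ((hxA.const_sub 1).smul hx')
    have heq : A.piecewise g g' x =
        A.indicator (1 : X → ℝ) x • g x + (1 - A.indicator (1 : X → ℝ) x) • g' x := by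
      by_cases hxA : x ∈ A <;> simp [hxA]
    rw [heq]
    exact this

/-! ### The dual functional and its upper bound by the divergence -/

lemma integrable_rnDeriv_mul {X : Type*} [MeasurableSpace X] {μ ν : Measure X} [IsFiniteMeasure μ]
    [IsFiniteMeasure ν] {v : X → ℝ} (hv : Integrable v μ) :
    Integrable (fun x => (μ.rnDeriv ν x).toReal * v x) ν := by
  have h : Integrable v (ν.withDensity (μ.rnDeriv ν)) :=
    hv.mono_measure (Measure.withDensity_rnDeriv_le μ ν)
  exact (integrable_withDensity_iff_integrable_smul' (Measure.measurable_rnDeriv μ ν)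
    (Measure.rnDeriv_lt_top μ ν)).1 h

/-- The integral with respect to the two parts of the Lebesgue decomposition. -/
lemma integral_eq_rnDeriv_add_singularPart {X : Type*} [MeasurableSpace X] {μ ν : Measure X}
    [IsFiniteMeasure μ] [IsFiniteMeasure ν] {v : X → ℝ} (hv : Integrable v μ) :
    ∫ x, v x ∂μ = ∫ x, (μ.rnDeriv ν x).toReal * v x ∂ν + ∫ x, v x ∂(μ.singularPart ν) := by
  have h1 : Integrable v (ν.withDensity (μ.rnDeriv ν)) :=
    hv.mono_measure (Measure.withDensity_rnDeriv_le μ ν)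
  have h2 : Integrable v (μ.singularPart ν) := hv.mono_measure (Measure.singularPart_le μ ν)
  have h3 := integral_withDensity_eq_integral_toReal_smul (Measure.measurable_rnDeriv μ ν)
    (Measure.rnDeriv_lt_top μ ν) v
  simp only [smul_eq_mul] at h3
  rw [← h3, add_comm, ← integral_add_measure h2 h1, ← μ.haveLebesgueDecomposition_add ν]

/-- The dual objective: `∫ u dν + ∫ v dξ` for `w = (u, v)`. -/
noncomputable def dualObjective {X : Type*} [MeasurableSpace X] (ν ξ : Measure X) (w : X → ℝ × ℝ) :
    ℝ :=
  ∫ x, (w x).1 ∂ν + ∫ x, (w x).2 ∂ξ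

lemma dualObjective_eq {X : Type*} [MeasurableSpace X] {ν ξ : Measure X} [IsFiniteMeasure ν]
    [IsFiniteMeasure ξ] {w : X → ℝ × ℝ} (h1 : Integrable (fun x => (w x).1) ν)
    (h2 : Integrable (fun x => (w x).2) ξ) :
    dualObjective ν ξ w = ∫ x, ((w x).1 + (w x).2 * (ξ.rnDeriv ν x).toReal) ∂ν +
      ∫ x, (w x).2 ∂(ξ.singularPart ν) := by
  rw [dualObjective, integral_eq_rnDeriv_add_singularPart (ν := ν) h2, ← add_assoc,
    ← integral_add h1 (integrable_rnDeriv_mul h2)]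
  simp only [mul_comm]

lemma ContinuousMap.integrable_of_compactSpace {X E : Type*} [TopologicalSpace X] [CompactSpace X]
    [MeasurableSpace X] [OpensMeasurableSpace X] [NormedAddCommGroup E]
    [SecondCountableTopologyEither X E] (μ : Measure X) [IsFiniteMeasure μ] (w : C(X, E)) :
    Integrable w μ := by
  refine Integrable.of_bound w.continuous.aestronglyMeasurable ‖w‖ (ae_of_all _ fun x => ?_)
  exact w.norm_coe_le_norm x

lemma dualObjective_le_fDivergence {X : Type*} [MetricSpace X] [CompactSpace X] [MeasurableSpace X]
    [BorelSpace X] {φ : ℝ → EReal} (ν ξ : ProbabilityMeasure X) {w : C(X, ℝ × ℝ)}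
    (hw : ∀ x, w x ∈ affineMinorants φ) :
    (dualObjective (ν : Measure X) (ξ : Measure X) w : EReal) ≤ fDivergence φ ξ ν := by
  have h1 : Integrable (fun x => (w x).1) (ν : Measure X) :=
    (w.integrable_of_compactSpace (ν : Measure X)).fst
  have h2 : ∀ μ : Measure X, IsFiniteMeasure μ → Integrable (fun x => (w x).2) μ :=
    fun μ _ => (w.integrable_of_compactSpace μ).snd
  rw [dualObjective_eq h1 (h2 _ inferInstance), EReal.coe_add, fDivergence]
  refine add_le_add ?_ ?_
  · have h3 := (integrable_rnDeriv_mul (ν := (ν : Measure X)) (h2 (ξ : Measure X) inferInstance))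
    rw [← erealIntegral_coe (by
      refine h1.add ?_
      simpa only [mul_comm] using h3)]
    exact erealIntegral_mono fun x => hw x _
  · have hX : Nonempty X := nonempty_of_isProbabilityMeasure (ξ : Measure X)
    -- By compactness the largest slope is attained, hence is the slope of a single minorant and at
    -- most `φ'(∞)`.
    obtain ⟨x0, -, hx0⟩ := isCompact_univ.exists_isMaxOn Set.univ_nonempty
      (continuous_snd.comp w.continuous).continuousOn
    set σ := (ξ : Measure X).singularPart (ν : Measure X)
    have h4 : ∫ x, (w x).2 ∂σ ≤ (w x0).2 * (σ Set.univ).toReal := by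
      calc ∫ x, (w x).2 ∂σ ≤ ∫ x, (w x0).2 ∂σ :=
            integral_mono (h2 σ inferInstance) (integrable_const _) fun x => hx0 (Set.mem_univ x)
        _ = _ := by simp [mul_comm, Measure.real]
    refine (EReal.coe_le_coe_iff.2 h4).trans ?_
    rw [EReal.coe_mul, EReal.coe_ennreal_toReal (measure_ne_top _ _)]
    exact mul_le_mul_of_nonneg_right (le_slopeAtTop (hw x0)) (EReal.coe_ennreal_nonneg _)

/-! ### Measurable selections recovering the divergence -/

open scoped Classical in
/-- The pairs `k n`, `n ≤ N`, selected so as to maximize a score (the first one in case of a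
tie). -/
noncomputable def selectMax {X : Type*} (k : ℕ → ℝ × ℝ) (s : X → ℝ × ℝ → ℝ) : ℕ → X → ℝ × ℝ
  | 0 => fun _ => k 0
  | N + 1 => {x | s x (selectMax k s N x) < s x (k (N + 1))}.piecewise (fun _ => k (N + 1))
      (selectMax k s N)

lemma score_selectMax {X : Type*} (k : ℕ → ℝ × ℝ) (s : X → ℝ × ℝ → ℝ) (N : ℕ) (x : X) :
    s x (selectMax k s N x) = partialSups (fun n => s x (k n)) N := by
  induction N with
  | zero => simp [selectMax]
  | succ N ih =>
    rw [partialSups_add_one, ← ih, selectMax]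
    by_cases h : s x (selectMax k s N x) < s x (k (N + 1))
    · rw [Set.piecewise_eq_of_mem {x | s x (selectMax k s N x) < s x (k (N + 1))} _ _ h, sup_eq_right.2 h.le]
    · rw [Set.piecewise_eq_of_notMem {x | s x (selectMax k s N x) < s x (k (N + 1))} _ _ h, sup_eq_left.2 (not_lt.1 h)]

lemma isBoundedContinuousLimit_selectMax {X : Type*} [MetricSpace X] [MeasurableSpace X]
    [BorelSpace X] {σ : Measure X} [IsFiniteMeasure σ] {K : Set (ℝ × ℝ)} (hK : Convex ℝ K)
    {k : ℕ → ℝ × ℝ} (hk : ∀ n, k n ∈ K) {s : X → ℝ × ℝ → ℝ}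
    (hs : Measurable (Function.uncurry s)) (N : ℕ) :
    IsBoundedContinuousLimit σ K (selectMax k s N) := by
  induction N with
  | zero => exact isBoundedContinuousLimit_const (hk 0)
  | succ N ih =>
    refine (isBoundedContinuousLimit_const (hk (N + 1))).piecewise hK ih ?_
    exact measurableSet_lt (hs.comp (measurable_id.prodMk ih.1))
      (hs.comp (measurable_id.prodMk measurable_const))

/-- Dominated convergence in both integrals; convergence almost everywhere for `ν + ξ` serves both
measures. -/
lemma IsBoundedContinuousLimit.exists_dualObjective_gt {X : Type*} [MetricSpace X]
    [MeasurableSpace X] [BorelSpace X] {ν ξ : Measure X} [IsFiniteMeasure ν] [IsFiniteMeasure ξ]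
    {K : Set (ℝ × ℝ)} {g : X → ℝ × ℝ} (hg : IsBoundedContinuousLimit (ν + ξ) K g) {c : ℝ}
    (hc : c < dualObjective ν ξ g) :
    ∃ w : C(X, ℝ × ℝ), (∀ x, w x ∈ K) ∧ c < dualObjective ν ξ w := by
  obtain ⟨-, C, -, w, hwK, hwC, hw⟩ := hg
  rw [ae_add_measure_iff] at hw
  have h1 : Tendsto (fun n => ∫ x, (w n x).1 ∂ν) atTop (𝓝 (∫ x, (g x).1 ∂ν)) := by
    refine tendsto_integral_of_dominated_convergence (fun _ => C)
      (fun n => (continuous_fst.comp (w n).continuous).measurable.aestronglyMeasurable)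
      (integrable_const C) (fun n => ae_of_all _ fun x => (norm_fst_le _).trans (hwC n x)) ?_
    filter_upwards [hw.1] with x hx using (continuous_fst.tendsto _).comp hx
  have h2 : Tendsto (fun n => ∫ x, (w n x).2 ∂ξ) atTop (𝓝 (∫ x, (g x).2 ∂ξ)) := by
    refine tendsto_integral_of_dominated_convergence (fun _ => C)
      (fun n => (continuous_snd.comp (w n).continuous).measurable.aestronglyMeasurable)
      (integrable_const C) (fun n => ae_of_all _ fun x => (norm_snd_le _).trans (hwC n x)) ?_
    filter_upwards [hw.2] with x hx using (continuous_snd.tendsto _).comp hx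
  obtain ⟨n, hn⟩ := ((h1.add h2).eventually (lt_mem_nhds hc)).exists
  exact ⟨w n, hwK n, hn⟩

lemma dualObjective_selectMax {X : Type*} [MetricSpace X] [MeasurableSpace X] [BorelSpace X]
    {ν ξ : Measure X} [IsFiniteMeasure ν] [IsFiniteMeasure ξ] {K : Set (ℝ × ℝ)} {S : Set X}
    (hνS : ν S = 0) (hξS : ξ.singularPart ν Sᶜ = 0) {k : ℕ → ℝ × ℝ} {s : X → ℝ × ℝ → ℝ}
    (hs1 : ∀ x ∈ S, ∀ p, s x p = p.2)
    (hs2 : ∀ x ∉ S, ∀ p, s x p = p.1 + p.2 * (ξ.rnDeriv ν x).toReal) (N : ℕ)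
    (hN : IsBoundedContinuousLimit (ν + ξ) K (selectMax k s N)) :
    dualObjective ν ξ (selectMax k s N) =
      ∫ x, partialSups (fun n => (k n).1 + (k n).2 * (ξ.rnDeriv ν x).toReal) N ∂ν +
        partialSups (fun n => (k n).2) N * (ξ.singularPart ν Set.univ).toReal := by
  obtain ⟨hm, C, hC, -⟩ := hN
  have hint : ∀ μ : Measure X, IsFiniteMeasure μ → Integrable (selectMax k s N) μ :=
    fun μ _ => Integrable.of_bound hm.aestronglyMeasurable C (ae_of_all _ hC)
  rw [dualObjective_eq (hint _ inferInstance).fst (hint _ inferInstance).snd]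
  congr 1
  · refine integral_congr_ae ?_
    filter_upwards [measure_eq_zero_iff_ae_notMem.1 hνS] with x hx
    rw [← hs2 x hx, score_selectMax k s]
    simp only [hs2 x hx]
  · have : ∫ x, (selectMax k s N x).2 ∂(ξ.singularPart ν) =
        ∫ _, partialSups (fun n => (k n).2) N ∂(ξ.singularPart ν) := by
      refine integral_congr_ae ?_
      filter_upwards [measure_eq_zero_iff_ae_notMem.1 hξS] with x hx
      rw [Set.notMem_compl_iff] at hx
      rw [← hs1 x hx, score_selectMax k s]
      simp only [hs1 x hx]
    rw [this]
    simp [mul_comm, Measure.real]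

/-- Continuous selections of affine minorants recover the divergence. -/
lemma exists_dualObjective_gt_of_lt_fDivergence {X : Type*} [MetricSpace X]
    [MeasurableSpace X] [BorelSpace X] {φ : ℝ → EReal} (hφ_proper : IsProperFn φ)
    (hφ_convex : IsConvexFn φ) (hφ_lsc : LowerSemicontinuous φ) {ν ξ : ProbabilityMeasure X} {c : ℝ}
    (hc : (c : EReal) < fDivergence φ ξ ν) :
    ∃ w : C(X, ℝ × ℝ), (∀ x, w x ∈ affineMinorants φ) ∧
      c < dualObjective (ν : Measure X) (ξ : Measure X) w := by
  have hK := affineMinorants_nonempty hφ_proper hφ_convex hφ_lsc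
  obtain ⟨k, hk, hkd⟩ := exists_dense_seq_in hK
  set f : X → ℝ := fun x => ((ξ : Measure X).rnDeriv (ν : Measure X) x).toReal
  set σ := (ξ : Measure X).singularPart (ν : Measure X)
  have hfm : Measurable f := (Measure.measurable_rnDeriv _ _).ennreal_toReal
  have hint0 : ∀ n, Integrable (fun x => (k n).1 + (k n).2 * f x) (ν : Measure X) := fun n =>
    (integrable_const _).add (Measure.integrable_toReal_rnDeriv.const_mul _)
  have hint : ∀ N, Integrable (fun x => partialSups (fun n => (k n).1 + (k n).2 * f x) N)
      (ν : Measure X) := by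
    intro N
    induction N with
    | zero => simpa using hint0 0
    | succ N ih =>
      simp only [partialSups_add_one]
      exact ih.sup (hint0 (N + 1))
  have hmeas : ∀ N, Measurable (fun x => partialSups (fun n => (k n).1 + (k n).2 * f x) N) := by
    intro N
    induction N with
    | zero => simpa using (hfm.const_mul _).const_add _
    | succ N ih =>
      simp only [partialSups_add_one]
      exact ih.sup ((hfm.const_mul _).const_add _)
  have T1 : Tendsto (fun N => ((∫ x, partialSups (fun n => (k n).1 + (k n).2 * f x) N
      ∂(ν : Measure X) : ℝ) : EReal)) atTop
      (𝓝 (erealIntegral (ν : Measure X) (fun x => φ (f x)))) := by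
    simp only [← erealIntegral_coe (hint _)]
    refine tendsto_erealIntegral_of_monotone (fun n => (hmeas n).coe_real_ereal)
      (fun x m n hmn => EReal.coe_le_coe_iff.2 ((partialSups _).monotone hmn)) (fun x => ?_) ?_
    · refine tendsto_partialSups_ereal (fun n => hk n (f x)) fun c hc => ?_
      obtain ⟨p, hp, hpc⟩ := exists_affineMinorant_gt hφ_proper hφ_convex hφ_lsc hc
      exact hkd {p | c < p.1 + p.2 * f x} (isOpen_lt (by fun_prop) (by fun_prop)) ⟨p, hp, hpc⟩
    · simp only [partialSups_zero, ← EReal.coe_neg, EReal.real_coe_toENNReal]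
      exact (hint0 0).neg.lintegral_lt_top.ne
  have T2 : Tendsto (fun N => ((partialSups (fun n => (k n).2) N * (σ Set.univ).toReal : ℝ) : EReal))
      atTop (𝓝 (slopeAtTop φ * ((σ Set.univ : ENNReal) : EReal))) := by
    have h1 : Tendsto (fun N => ((partialSups (fun n => (k n).2) N : ℝ) : EReal)) atTop
        (𝓝 (slopeAtTop φ)) := by
      refine tendsto_partialSups_ereal (fun n => le_slopeAtTop (hk n)) fun c hc => ?_
      obtain ⟨c', hcc', hc'⟩ := EReal.lt_iff_exists_real_btwn.1 hc
      obtain ⟨p, hp, hpc⟩ := exists_affineMinorant_slope_ge hK hc'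
      exact hkd {p | c < p.2} (isOpen_lt (by fun_prop) (by fun_prop))
        ⟨p, hp, (EReal.coe_lt_coe_iff.1 hcc').trans_le hpc⟩
    have hne : σ Set.univ ≠ ⊤ := measure_ne_top _ _
    by_cases h0 : σ Set.univ = 0
    · simp [h0]
    · simp only [EReal.coe_mul, EReal.coe_ennreal_toReal hne]
      have h2 : ((σ Set.univ : ENNReal) : EReal) ≠ 0 := by
        rwa [Ne, EReal.coe_ennreal_eq_zero]
      have h3 : ((σ Set.univ : ENNReal) : EReal) ≠ ⊤ := by
        rwa [Ne, EReal.coe_ennreal_eq_top_iff]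
      exact (EReal.continuousAt_mul (p := (slopeAtTop φ, ((σ Set.univ : ENNReal) : EReal)))
        (Or.inr (EReal.coe_ennreal_ne_bot _)) (Or.inr h3) (Or.inr h2) (Or.inr h2)).tendsto.comp
        (h1.prodMk_nhds tendsto_const_nhds)
  -- Neither limit is `⊥`, so addition is continuous at the pair of limits.
  have h1 : erealIntegral (ν : Measure X) (fun x => φ (f x)) ≠ ⊥ := by
    refine ((EReal.bot_lt_coe (∫ x, ((k 0).1 + (k 0).2 * f x) ∂(ν : Measure X))).trans_le ?_).ne'
    rw [← erealIntegral_coe (hint0 0)]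
    exact erealIntegral_mono fun x => hk 0 _
  have h2 : slopeAtTop φ * ((σ Set.univ : ENNReal) : EReal) ≠ ⊥ := by
    refine ((EReal.bot_lt_coe ((k 0).2 * (σ Set.univ).toReal)).trans_le ?_).ne'
    rw [EReal.coe_mul, EReal.coe_ennreal_toReal (measure_ne_top _ _)]
    exact mul_le_mul_of_nonneg_right (le_slopeAtTop (hk 0)) (EReal.coe_ennreal_nonneg _)
  have T := (EReal.continuousAt_add (p := (_, _)) (Or.inr h2) (Or.inl h1)).tendsto.comp
    (T1.prodMk_nhds T2)
  obtain ⟨N, hN⟩ := (T.eventually (lt_mem_nhds hc)).exists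
  obtain ⟨S, hS, hξS, hνS⟩ := (ξ : Measure X).mutuallySingular_singularPart (ν : Measure X)
  classical
  -- `Sᶜ` is `ν`-null and carries the singular part, so there the score is the slope alone;
  -- elsewhere it is the minorant's value at the density.
  set s : X → ℝ × ℝ → ℝ := fun x p => if x ∈ Sᶜ then p.2 else p.1 + p.2 * f x
  have hsm : Measurable (Function.uncurry s) :=
    Measurable.ite (measurable_fst hS.compl) (by fun_prop) (by fun_prop)
  have hlim := isBoundedContinuousLimit_selectMax
    (σ := (ν : Measure X) + (ξ : Measure X)) (convex_affineMinorants φ) hk hsm N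
  refine hlim.exists_dualObjective_gt ?_
  rw [dualObjective_selectMax (S := Sᶜ) hνS (by rwa [compl_compl])
    (fun x hx p => if_pos hx) (fun x hx p => if_neg hx) N hlim]
  exact EReal.coe_lt_coe_iff.1 (by rw [EReal.coe_add]; exact hN)

/-! ### Weak lower semicontinuity and elementary values of the divergence -/

lemma continuous_integral_probabilityMeasure {X : Type*} [MetricSpace X] [CompactSpace X]
    [MeasurableSpace X] [OpensMeasurableSpace X] (v : C(X, ℝ)) :
    Continuous fun ξ : ProbabilityMeasure X => ∫ x, v x ∂(ξ : Measure X) := by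
  rw [continuous_iff_continuousAt]
  intro ξ
  exact (ProbabilityMeasure.tendsto_iff_forall_integral_tendsto.1 tendsto_id)
    (BoundedContinuousFunction.mkOfCompact v)

theorem lowerSemicontinuous_fDivergence {X : Type*} [MetricSpace X] [CompactSpace X]
    [MeasurableSpace X] [BorelSpace X] {φ : ℝ → EReal} (hφ_proper : IsProperFn φ)
    (hφ_convex : IsConvexFn φ) (hφ_lsc : LowerSemicontinuous φ) (ν : ProbabilityMeasure X) :
    LowerSemicontinuous fun ξ : ProbabilityMeasure X => fDivergence φ ξ ν := by
  intro ξ c hc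
  obtain ⟨c', hcc', hc'⟩ := EReal.lt_iff_exists_real_btwn.1 hc
  obtain ⟨w, hw, hcw⟩ :=
    exists_dualObjective_gt_of_lt_fDivergence hφ_proper hφ_convex hφ_lsc hc'
  have hcont : Continuous fun ξ : ProbabilityMeasure X =>
      dualObjective (ν : Measure X) (ξ : Measure X) w :=
    continuous_const.add (continuous_integral_probabilityMeasure ⟨_, continuous_snd.comp w.continuous⟩)
  filter_upwards [hcont.continuousAt.eventually (lt_mem_nhds hcw)] with ξ' hξ'
  exact (hcc'.trans (EReal.coe_lt_coe_iff.2 hξ')).trans_le (dualObjective_le_fDivergence ν ξ' hw)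

lemma exists_real_le_fDivergence {X : Type*} [MetricSpace X] [CompactSpace X]
    [MeasurableSpace X] [BorelSpace X] {φ : ℝ → EReal} (hφ_proper : IsProperFn φ)
    (hφ_convex : IsConvexFn φ) (hφ_lsc : LowerSemicontinuous φ) (ν : ProbabilityMeasure X) :
    ∃ m : ℝ, ∀ ξ : ProbabilityMeasure X, (m : EReal) ≤ fDivergence φ ξ ν := by
  obtain ⟨p, hp⟩ := affineMinorants_nonempty hφ_proper hφ_convex hφ_lsc
  refine ⟨p.1 + p.2, fun ξ => ?_⟩
  have := dualObjective_le_fDivergence ν ξ (w := ContinuousMap.const X p) fun _ => hp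
  simpa [dualObjective] using this

lemma fDivergence_self {X : Type*} [MeasurableSpace X] {φ : ℝ → EReal}
    (ν : ProbabilityMeasure X) : fDivergence φ ν ν = φ 1 := by
  have h : ∀ᵐ x ∂(ν : Measure X), φ ((ν : Measure X).rnDeriv (ν : Measure X) x).toReal = φ 1 := by
    filter_upwards [Measure.rnDeriv_self (ν : Measure X)] with x hx
    simp [hx]
  have h1 := lintegral_congr_ae (h.mono fun x hx => congrArg EReal.toENNReal hx)
  have h2 := lintegral_congr_ae (h.mono fun x hx => congrArg (fun y => (-y).toENNReal) hx)
  rw [fDivergence, erealIntegral]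
  rw [h1, h2, Measure.singularPart_self]
  rcases le_total 0 (φ 1) with h0 | h0
  · simp [EReal.toENNReal_of_nonpos (EReal.neg_le_zero.2 h0), EReal.coe_toENNReal h0]
  · simp [EReal.toENNReal_of_nonpos h0, EReal.coe_toENNReal (EReal.neg_nonneg.2 h0)]

/-! ### The Wasserstein distance -/

lemma integral_dist_nonneg {X : Type*} [MetricSpace X] [MeasurableSpace X] (π : Measure (X × X)) :
    0 ≤ ∫ z, dist z.1 z.2 ∂π :=
  integral_nonneg fun _ => dist_nonneg

lemma wasserstein1_le {X : Type*} [MetricSpace X] [MeasurableSpace X] {μ ν : ProbabilityMeasure X}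
    {π : ProbabilityMeasure (X × X)} (hπ : π ∈ couplings μ ν) : wasserstein1 μ ν ≤ ∫ z, dist z.1 z.2 ∂(π : Measure (X × X)) :=
  ciInf_le (f := fun π : couplings μ ν => ∫ z, dist z.1 z.2 ∂(π.1 : Measure (X × X)))
    ⟨0, Set.forall_mem_range.2 fun _ => integral_dist_nonneg _⟩ ⟨π, hπ⟩

lemma wasserstein1_nonneg {X : Type*} [MetricSpace X] [MeasurableSpace X] (μ ν : ProbabilityMeasure X) :
    0 ≤ wasserstein1 μ ν :=
  Real.iInf_nonneg fun _ => integral_dist_nonneg _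

lemma mem_couplings_iff {X : Type*} [MeasurableSpace X] {μ ν : ProbabilityMeasure X}
    {π : ProbabilityMeasure (X × X)} :
    π ∈ couplings μ ν ↔ π.map (f := Prod.fst) measurable_fst.aemeasurable = μ ∧
      π.map (f := Prod.snd) measurable_snd.aemeasurable = ν :=
  ⟨fun h => ⟨Subtype.ext h.1, Subtype.ext h.2⟩,
    fun h => ⟨congrArg Subtype.val h.1, congrArg Subtype.val h.2⟩⟩

section Wasserstein

variable {X : Type*} [MetricSpace X] [CompactSpace X] [MeasurableSpace X] [BorelSpace X]

/-- The distance as a continuous function on the product. -/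
def distMap (X : Type*) [MetricSpace X] : C(X × X, ℝ) := ⟨fun z => dist z.1 z.2, continuous_dist⟩

lemma integrable_dist (π : Measure (X × X)) [IsFiniteMeasure π] :
    Integrable (fun z : X × X => dist z.1 z.2) π :=
  (distMap X).integrable_of_compactSpace π

lemma prod_mem_couplings (μ ν : ProbabilityMeasure X) : μ.prod ν ∈ couplings μ ν := by
  constructor <;> simp

/-- The couplings form a closed subset of the compact space of probability measures on `X × X`, and
the cost is weakly continuous. -/
lemma exists_optimal_coupling (μ ν : ProbabilityMeasure X) :
    ∃ π ∈ couplings μ ν, ∫ z, dist z.1 z.2 ∂(π : Measure (X × X)) = wasserstein1 μ ν := by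
  have hclosed : IsClosed (couplings μ ν) := by
    have : couplings μ ν = {π | π.map (f := Prod.fst) measurable_fst.aemeasurable = μ} ∩
        {π | π.map (f := Prod.snd) measurable_snd.aemeasurable = ν} :=
      Set.ext fun π => mem_couplings_iff
    rw [this]
    exact (isClosed_eq (ProbabilityMeasure.continuous_map continuous_fst) continuous_const).inter
      (isClosed_eq (ProbabilityMeasure.continuous_map continuous_snd) continuous_const)
  obtain ⟨π, hπ, hmin⟩ := hclosed.isCompact.exists_isMinOn ⟨_, prod_mem_couplings μ ν⟩
    (continuous_integral_probabilityMeasure (distMap X)).continuousOn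
  refine ⟨π, hπ, le_antisymm ?_ (wasserstein1_le hπ)⟩
  have : Nonempty (couplings μ ν) := ⟨⟨_, hπ⟩⟩
  exact le_ciInf fun π' => hmin π'.2

lemma wasserstein1_le_diam (μ ν : ProbabilityMeasure X) :
    wasserstein1 μ ν ≤ Metric.diam (Set.univ : Set X) := by
  refine (wasserstein1_le (prod_mem_couplings μ ν)).trans ?_
  calc _ ≤ ∫ _, Metric.diam (Set.univ : Set X) ∂(μ.prod ν : Measure (X × X)) :=
        integral_mono (integrable_dist _) (integrable_const _) fun z =>
          Metric.dist_le_diam_of_mem isCompact_univ.isBounded (Set.mem_univ _) (Set.mem_univ _)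
    _ = _ := by simp

lemma wasserstein1_self (μ : ProbabilityMeasure X) : wasserstein1 μ μ = 0 := by
  have hd : Measurable fun x : X => (x, x) := measurable_id.prodMk measurable_id
  refine le_antisymm ?_ (wasserstein1_nonneg μ μ)
  refine (wasserstein1_le (π := μ.map hd.aemeasurable) ⟨?_, ?_⟩).trans (le_of_eq ?_)
  · rw [ProbabilityMeasure.toMeasure_map, Measure.map_map measurable_fst hd]
    exact Measure.map_id
  · rw [ProbabilityMeasure.toMeasure_map, Measure.map_map measurable_snd hd]
    exact Measure.map_id
  · rw [ProbabilityMeasure.toMeasure_map, integral_map hd.aemeasurable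
      continuous_dist.measurable.aestronglyMeasurable]
    simp

lemma wasserstein1_comm (μ ν : ProbabilityMeasure X) : wasserstein1 μ ν = wasserstein1 ν μ := by
  have key : ∀ μ ν : ProbabilityMeasure X, wasserstein1 μ ν ≤ wasserstein1 ν μ := by
    intro μ ν
    obtain ⟨π, hπ, hW⟩ := exists_optimal_coupling ν μ
    rw [← hW]
    refine (wasserstein1_le (π := π.map measurable_swap.aemeasurable) ⟨?_, ?_⟩).trans
      (le_of_eq ?_)
    · rw [ProbabilityMeasure.toMeasure_map, Measure.map_map measurable_fst measurable_swap]
      exact hπ.2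
    · rw [ProbabilityMeasure.toMeasure_map, Measure.map_map measurable_snd measurable_swap]
      exact hπ.1
    · rw [ProbabilityMeasure.toMeasure_map, integral_map measurable_swap.aemeasurable
        continuous_dist.measurable.aestronglyMeasurable]
      simp [dist_comm]
  exact le_antisymm (key _ _) (key _ _)

/-- Two couplings with a common middle marginal are the marginals of a measure on the triple
product. -/
lemma exists_gluing {μ₁ μ₂ μ₃ : ProbabilityMeasure X} {π π' : ProbabilityMeasure (X × X)}
    (hπ : π ∈ couplings μ₁ μ₂) (hπ' : π' ∈ couplings μ₂ μ₃) :
    ∃ ρ : ProbabilityMeasure ((X × X) × X),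
      (ρ : Measure ((X × X) × X)).map Prod.fst = (π : Measure (X × X)) ∧
      (ρ : Measure ((X × X) × X)).map (fun z => (z.1.2, z.2)) = (π' : Measure (X × X)) := by
  have hX : Nonempty X := nonempty_of_isProbabilityMeasure (μ₁ : Measure X)
  set κ := (π' : Measure (X × X)).condKernel
  set κ' : ProbabilityTheory.Kernel (X × X) X := κ.comap Prod.snd measurable_snd
  -- Draw `(x₁, x₂)` from `π`, then `x₃` from the conditional law of `π'` given `x₂`.
  refine ⟨⟨(π : Measure (X × X)).compProd κ', inferInstance⟩,
    Measure.fst_compProd (π : Measure (X × X)) κ', ?_⟩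
  have hdis : (μ₂ : Measure X).compProd κ = π' := by
    have := (π' : Measure (X × X)).disintegrate κ
    rwa [Measure.fst, hπ'.1] at this
  have hm : Measurable fun z : (X × X) × X => (z.1.2, z.2) := by fun_prop
  refine Eq.trans (b := (μ₂ : Measure X).compProd κ) ?_ hdis
  change ((π : Measure (X × X)).compProd κ').map _ = _
  ext s hs
  rw [Measure.map_apply hm hs, Measure.compProd_apply (hm hs),
    Measure.compProd_apply hs, ← hπ.2,
    lintegral_map (ProbabilityTheory.Kernel.measurable_kernel_prodMk_left hs) measurable_snd]
  rfl

lemma wasserstein1_triangle (μ₁ μ₂ μ₃ : ProbabilityMeasure X) :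
    wasserstein1 μ₁ μ₃ ≤ wasserstein1 μ₁ μ₂ + wasserstein1 μ₂ μ₃ := by
  obtain ⟨π, hπ, hW⟩ := exists_optimal_coupling μ₁ μ₂
  obtain ⟨π', hπ', hW'⟩ := exists_optimal_coupling μ₂ μ₃
  obtain ⟨ρ, h1, h2⟩ := exists_gluing hπ hπ'
  have hm : Measurable fun z : (X × X) × X => (z.1.2, z.2) := by fun_prop
  have hm' : Measurable fun z : (X × X) × X => (z.1.1, z.2) := by fun_prop
  have hd : StronglyMeasurable fun z : X × X => dist z.1 z.2 :=
    continuous_dist.measurable.stronglyMeasurable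
  rw [← hW, ← hW', ← h1, ← h2, integral_map measurable_fst.aemeasurable hd.aestronglyMeasurable,
    integral_map hm.aemeasurable hd.aestronglyMeasurable]
  have i1 : Integrable (fun z : (X × X) × X => dist z.1.1 z.1.2) (ρ : Measure _) :=
    ContinuousMap.integrable_of_compactSpace (ρ : Measure _)
      ⟨fun z : (X × X) × X => dist z.1.1 z.1.2, by fun_prop⟩
  have i2 : Integrable (fun z : (X × X) × X => dist z.1.2 z.2) (ρ : Measure _) :=
    ContinuousMap.integrable_of_compactSpace (ρ : Measure _)
      ⟨fun z : (X × X) × X => dist z.1.2 z.2, by fun_prop⟩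
  have i3 : Integrable (fun z : (X × X) × X => dist z.1.1 z.2) (ρ : Measure _) :=
    ContinuousMap.integrable_of_compactSpace (ρ : Measure _)
      ⟨fun z : (X × X) × X => dist z.1.1 z.2, by fun_prop⟩
  refine (wasserstein1_le (π := ρ.map hm'.aemeasurable) ⟨?_, ?_⟩).trans ?_
  · rw [ProbabilityMeasure.toMeasure_map, Measure.map_map measurable_fst hm', ← hπ.1, ← h1,
      Measure.map_map measurable_fst measurable_fst]
    rfl
  · rw [ProbabilityMeasure.toMeasure_map, Measure.map_map measurable_snd hm', ← hπ'.2, ← h2,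
      Measure.map_map measurable_snd hm]
    rfl
  · rw [ProbabilityMeasure.toMeasure_map, integral_map hm'.aemeasurable hd.aestronglyMeasurable,
      ← integral_add i1 i2]
    exact integral_mono i3 (i1.add i2) fun z => dist_triangle _ _ _

end Wasserstein

/-! ### Stability of lower bounds on the divergence under `W₁` -/

/-- A continuous function on a compact space is Lipschitz up to an arbitrarily small additive
error. -/
lemma exists_sub_le_add_mul_dist {X : Type*} [MetricSpace X] [CompactSpace X] (v : C(X, ℝ))
    {ε : ℝ} (hε : 0 < ε) : ∃ L : ℝ, 0 ≤ L ∧ ∀ x y, v x - v y ≤ ε + L * dist x y := by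
  obtain ⟨δ, hδ, h⟩ := Metric.uniformContinuous_iff.1
    (CompactSpace.uniformContinuous_of_continuous v.continuous) ε hε
  -- Pairs closer than `δ` cost at most `ε`; for the others the total oscillation `2 * ‖v‖` is
  -- absorbed by the linear term.
  refine ⟨2 * ‖v‖ / δ, by positivity, fun x y => ?_⟩
  rcases lt_or_ge (dist x y) δ with hxy | hxy
  · have h1 := (le_abs_self _).trans_lt (h hxy)
    have h2 : 0 ≤ 2 * ‖v‖ / δ * dist x y := by positivity
    linarith
  · have h1 := abs_le.1 (v.norm_coe_le_norm x)
    have h2 := abs_le.1 (v.norm_coe_le_norm y)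
    have h3 : 2 * ‖v‖ ≤ 2 * ‖v‖ / δ * dist x y := by
      rw [div_mul_eq_mul_div, le_div_iff₀ hδ]
      exact mul_le_mul_of_nonneg_left hxy (by positivity)
    linarith [h1.2, h2.1]

lemma exists_wasserstein1_lt_imp_lt_fDivergence {X : Type*} [MetricSpace X] [CompactSpace X]
    [MeasurableSpace X] [BorelSpace X] {φ : ℝ → EReal} (hφ_proper : IsProperFn φ)
    (hφ_convex : IsConvexFn φ) (hφ_lsc : LowerSemicontinuous φ) {ν μ : ProbabilityMeasure X} {c : ℝ}
    (hc : (c : EReal) < fDivergence φ μ ν) :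
    ∃ δ > 0, ∀ ξ : ProbabilityMeasure X, wasserstein1 μ ξ < δ → (c : EReal) < fDivergence φ ξ ν := by
  obtain ⟨w, hw, hcw⟩ :=
    exists_dualObjective_gt_of_lt_fDivergence hφ_proper hφ_convex hφ_lsc hc
  set ε := (dualObjective (ν : Measure X) (μ : Measure X) w - c) / 2 with hε
  have hε0 : 0 < ε := by rw [hε]; linarith
  obtain ⟨L, hL, hv⟩ := exists_sub_le_add_mul_dist ⟨_, continuous_snd.comp w.continuous⟩ hε0
  -- The dual value drops by at most `ε + L * W₁ < 2 * ε`, the whole gap above `c`. The `+ 1` covers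
  -- `L = 0`.
  refine ⟨ε / (L + 1), by positivity, fun ξ hξ => ?_⟩
  refine lt_of_lt_of_le (EReal.coe_lt_coe_iff.2 ?_) (dualObjective_le_fDivergence ν ξ hw)
  obtain ⟨π, hπ, hW⟩ := exists_optimal_coupling μ ξ
  have hvm : StronglyMeasurable fun x => (w x).2 :=
    (continuous_snd.comp w.continuous).measurable.stronglyMeasurable
  have h1 : ∫ x, (w x).2 ∂(μ : Measure X) = ∫ z, (w z.1).2 ∂(π : Measure (X × X)) := by
    rw [← hπ.1, integral_map measurable_fst.aemeasurable hvm.aestronglyMeasurable]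
  have h2 : ∫ x, (w x).2 ∂(ξ : Measure X) = ∫ z, (w z.2).2 ∂(π : Measure (X × X)) := by
    rw [← hπ.2, integral_map measurable_snd.aemeasurable hvm.aestronglyMeasurable]
  have i1 : Integrable (fun z : X × X => (w z.1).2) (π : Measure (X × X)) :=
    ContinuousMap.integrable_of_compactSpace (π : Measure _) ⟨fun z : X × X => (w z.1).2, by fun_prop⟩
  have i2 : Integrable (fun z : X × X => (w z.2).2) (π : Measure (X × X)) :=
    ContinuousMap.integrable_of_compactSpace (π : Measure _) ⟨fun z : X × X => (w z.2).2, by fun_prop⟩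
  have h3 : ∫ x, (w x).2 ∂(μ : Measure X) - ∫ x, (w x).2 ∂(ξ : Measure X) ≤
      ε + L * wasserstein1 μ ξ := by
    rw [h1, h2, ← integral_sub i1 i2, ← hW]
    calc _ ≤ ∫ z : X × X, (ε + L * dist z.1 z.2) ∂(π : Measure (X × X)) :=
          integral_mono (i1.sub i2)
            ((integrable_const ε).add ((integrable_dist _).const_mul L)) fun z => hv z.1 z.2
      _ = _ := by
          rw [integral_add (integrable_const ε) ((integrable_dist _).const_mul L),
            integral_const_mul]
          simp
  have h4 : L * wasserstein1 μ ξ < ε := by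
    rw [lt_div_iff₀ (by positivity)] at hξ
    have := wasserstein1_nonneg μ ξ
    linarith
  simp only [dualObjective] at hε ⊢
  linarith

/-! ### Attainment, convergence and regularity of the approximation -/

section MoreauYosida

variable {X : Type*} [MetricSpace X] [CompactSpace X] [MeasurableSpace X] [BorelSpace X]

theorem exists_moreauYosidaObjective_eq {φ : ℝ → EReal} (hφ_proper : IsProperFn φ)
    (hφ_convex : IsConvexFn φ) (hφ_lsc : LowerSemicontinuous φ) (ν : ProbabilityMeasure X) {α : ℝ}
    (hα : 0 < α) (μ : ProbabilityMeasure X) {l : ℝ} (hl : 0 < l) :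
    ∃ ξ : ProbabilityMeasure X,
      moreauYosidaObjective φ l α μ ν ξ = moreauYosidaDivergence φ l α μ ν := by
  -- Minimizing over plans instead of second marginals replaces `W₁` by a weakly continuous cost, so
  -- no semicontinuity of `W₁` is needed.
  set S : Set (ProbabilityMeasure (X × X)) :=
    {π | π.map (f := Prod.fst) measurable_fst.aemeasurable = μ}
  have hS : IsCompact S := (isClosed_eq (ProbabilityMeasure.continuous_map continuous_fst)
    continuous_const).isCompact
  set snd : ProbabilityMeasure (X × X) → ProbabilityMeasure X :=
    fun π => π.map (f := Prod.snd) measurable_snd.aemeasurable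
  set G : ProbabilityMeasure (X × X) → EReal := fun π =>
    fDivergence φ (snd π) ν + ((l * (∫ z, dist z.1 z.2 ∂(π : Measure (X × X))) ^ α : ℝ) : EReal)
  have hG : LowerSemicontinuous G := by
    have h1 : Continuous fun π : ProbabilityMeasure (X × X) =>
        ∫ z, dist z.1 z.2 ∂(π : Measure (X × X)) :=
      continuous_integral_probabilityMeasure (distMap X)
    have h2 : Continuous fun π : ProbabilityMeasure (X × X) =>
        ((l * (∫ z, dist z.1 z.2 ∂(π : Measure (X × X))) ^ α : ℝ) : EReal) :=
      continuous_coe_real_ereal.comp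
        (continuous_const.mul (h1.rpow_const fun _ => Or.inr hα.le))
    refine LowerSemicontinuous.add'
      ((lowerSemicontinuous_fDivergence hφ_proper hφ_convex hφ_lsc ν).comp
        (ProbabilityMeasure.continuous_map continuous_snd)) h2.lowerSemicontinuous fun π => ?_
    exact EReal.continuousAt_add (Or.inr (EReal.coe_ne_bot _)) (Or.inr (EReal.coe_ne_top _))
  obtain ⟨π, hπ, hmin⟩ := (hG.lowerSemicontinuousOn S).exists_isMinOn
    ⟨μ.prod μ, (mem_couplings_iff.1 (prod_mem_couplings μ μ)).1⟩ hS
  refine ⟨snd π, le_antisymm (le_iInf fun ξ => ?_) (iInf_le _ _)⟩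
  obtain ⟨π', hπ', hW⟩ := exists_optimal_coupling μ ξ
  obtain ⟨h1, h2⟩ := mem_couplings_iff.1 hπ'
  calc moreauYosidaObjective φ l α μ ν (snd π) ≤ G π := by
        refine add_le_add le_rfl (EReal.coe_le_coe_iff.2 (mul_le_mul_of_nonneg_left ?_ hl.le))
        exact Real.rpow_le_rpow (wasserstein1_nonneg _ _)
          (wasserstein1_le (mem_couplings_iff.2 ⟨hπ, rfl⟩)) hα.le
    _ ≤ G π' := hmin h1
    _ = moreauYosidaObjective φ l α μ ν ξ := by
        simp only [G, snd, h2, hW, moreauYosidaObjective]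

lemma moreauYosidaDivergence_le_fDivergence (φ : ℝ → EReal) {α : ℝ} (hα : 0 < α) (l : ℝ)
    (μ ν : ProbabilityMeasure X) : moreauYosidaDivergence φ l α μ ν ≤ fDivergence φ μ ν := by
  refine (iInf_le _ μ).trans (le_of_eq ?_)
  simp [moreauYosidaObjective, wasserstein1_self, Real.zero_rpow hα.ne']

lemma eventually_le_moreauYosidaDivergence {φ : ℝ → EReal} (hφ_proper : IsProperFn φ)
    (hφ_convex : IsConvexFn φ) (hφ_lsc : LowerSemicontinuous φ) {ν μ : ProbabilityMeasure X}
    {α : ℝ} (hα : 0 < α) {c : ℝ} (hc : (c : EReal) < fDivergence φ μ ν) :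
    ∀ᶠ l : ℝ in atTop, (c : EReal) ≤ moreauYosidaDivergence φ l α μ ν := by
  obtain ⟨δ, hδ, h⟩ :=
    exists_wasserstein1_lt_imp_lt_fDivergence hφ_proper hφ_convex hφ_lsc hc
  obtain ⟨m, hm⟩ := exists_real_le_fDivergence hφ_proper hφ_convex hφ_lsc ν
  have hδα : 0 < δ ^ α := Real.rpow_pos_of_pos hδ α
  -- From this threshold on, `m + l * δ ^ α ≥ c`, which settles every `ξ` at distance at least `δ`.
  filter_upwards [eventually_ge_atTop 0, eventually_ge_atTop ((c - m) / δ ^ α)] with l hl0 hl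
  refine le_iInf fun ξ => ?_
  have hW : 0 ≤ wasserstein1 μ ξ := wasserstein1_nonneg μ ξ
  rcases lt_or_ge (wasserstein1 μ ξ) δ with hξ | hξ
  · have h1 : (0 : EReal) ≤ ((l * wasserstein1 μ ξ ^ α : ℝ) : EReal) := by
      exact_mod_cast mul_nonneg hl0 (Real.rpow_nonneg hW α)
    simpa [moreauYosidaObjective] using add_le_add (h ξ hξ).le h1
  · refine le_trans ?_ (add_le_add (hm ξ) le_rfl)
    rw [← EReal.coe_add, EReal.coe_le_coe_iff]
    rw [div_le_iff₀ hδα] at hl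
    have h2 : l * δ ^ α ≤ l * wasserstein1 μ ξ ^ α :=
      mul_le_mul_of_nonneg_left (Real.rpow_le_rpow hδ.le hξ hα.le) hl0
    linarith

theorem tendsto_moreauYosidaDivergence {φ : ℝ → EReal} (hφ_proper : IsProperFn φ)
    (hφ_convex : IsConvexFn φ) (hφ_lsc : LowerSemicontinuous φ) (ν μ : ProbabilityMeasure X)
    {α : ℝ} (hα : 0 < α) :
    Tendsto (fun l : ℝ => moreauYosidaDivergence φ l α μ ν) atTop (𝓝 (fDivergence φ μ ν)) := by
  rw [tendsto_order]
  refine ⟨fun c hc => ?_, fun c hc => Eventually.of_forall fun l =>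
    (moreauYosidaDivergence_le_fDivergence φ hα l μ ν).trans_lt hc⟩
  obtain ⟨c', hcc', hc'⟩ := EReal.lt_iff_exists_real_btwn.1 hc
  exact (eventually_le_moreauYosidaDivergence hφ_proper hφ_convex hφ_lsc hα hc').mono
    fun l hl => hcc'.trans_le hl

theorem fDivergence_eq_iSup_moreauYosidaDivergence {φ : ℝ → EReal} (hφ_proper : IsProperFn φ)
    (hφ_convex : IsConvexFn φ) (hφ_lsc : LowerSemicontinuous φ) (ν μ : ProbabilityMeasure X)
    {α : ℝ} (hα : 0 < α) :
    fDivergence φ μ ν = ⨆ (l : ℝ) (_ : 0 < l), moreauYosidaDivergence φ l α μ ν := by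
  refine le_antisymm ?_ (iSup₂_le fun l _ => moreauYosidaDivergence_le_fDivergence φ hα l μ ν)
  refine le_of_tendsto (tendsto_moreauYosidaDivergence hφ_proper hφ_convex hφ_lsc ν μ hα) ?_
  filter_upwards [eventually_gt_atTop (0 : ℝ)] with l hl
  exact le_iSup₂_of_le l hl le_rfl

lemma moreauYosidaDivergence_ne_top_bot {φ : ℝ → EReal} (hφ_proper : IsProperFn φ)
    (hφ_convex : IsConvexFn φ) (hφ_lsc : LowerSemicontinuous φ) (h1 : φ 1 < ⊤)
    (ν μ : ProbabilityMeasure X) {α l : ℝ} (hl : 0 < l) :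
    moreauYosidaDivergence φ l α μ ν ≠ ⊤ ∧ moreauYosidaDivergence φ l α μ ν ≠ ⊥ := by
  constructor
  · refine ((iInf_le _ ν).trans_lt ?_).ne
    rw [moreauYosidaObjective, fDivergence_self]
    exact EReal.add_lt_top h1.ne (EReal.coe_ne_top _)
  · obtain ⟨m, hm⟩ := exists_real_le_fDivergence hφ_proper hφ_convex hφ_lsc ν
    refine ((EReal.bot_lt_coe m).trans_le (le_iInf fun ξ => ?_)).ne'
    have h1 : (0 : EReal) ≤ ((l * wasserstein1 μ ξ ^ α : ℝ) : EReal) := by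
      exact_mod_cast mul_nonneg hl.le (Real.rpow_nonneg (wasserstein1_nonneg μ ξ) α)
    simpa [moreauYosidaObjective] using add_le_add (hm ξ) h1

/-- The Moreau-Yosida approximation inherits the modulus of continuity of `t ↦ l * t ^ α` on the
range of `W₁`. -/
lemma isHolderW1_moreauYosidaDivergence {φ : ℝ → EReal} (hφ_proper : IsProperFn φ)
    (hφ_convex : IsConvexFn φ) (hφ_lsc : LowerSemicontinuous φ) (h1 : φ 1 < ⊤)
    (ν : ProbabilityMeasure X) {α l C r : ℝ} (hα : 0 < α) (hl : 0 < l)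
    (hC : ∀ a b w : ℝ, 0 ≤ a → 0 ≤ b → 0 ≤ w → a ≤ Metric.diam (Set.univ : Set X) → a ≤ w + b →
      l * a ^ α ≤ l * b ^ α + C * w ^ r) :
    IsHolderW1 C r fun μ => moreauYosidaDivergence φ l α μ ν := by
  have hfin := fun μ => moreauYosidaDivergence_ne_top_bot hφ_proper hφ_convex hφ_lsc h1 ν μ
    (α := α) hl
  refine ⟨hfin, ?_⟩
  have key : ∀ μ₁ μ₂ : ProbabilityMeasure X, (moreauYosidaDivergence φ l α μ₁ ν).toReal ≤
      (moreauYosidaDivergence φ l α μ₂ ν).toReal + C * wasserstein1 μ₁ μ₂ ^ r := by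
    intro μ₁ μ₂
    -- The minimizer for `μ₂` is used as a competitor for `μ₁`; the divergence terms agree and only
    -- the penalties are compared.
    obtain ⟨ξ, hξ⟩ := exists_moreauYosidaObjective_eq hφ_proper hφ_convex hφ_lsc ν hα μ₂ hl
    rw [← EReal.coe_le_coe_iff, EReal.coe_add, EReal.coe_toReal (hfin μ₁).1 (hfin μ₁).2,
      EReal.coe_toReal (hfin μ₂).1 (hfin μ₂).2, ← hξ]
    refine (iInf_le _ ξ).trans ?_
    rw [moreauYosidaObjective, moreauYosidaObjective, add_assoc, ← EReal.coe_add]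
    refine add_le_add le_rfl (EReal.coe_le_coe_iff.2 ?_)
    exact hC _ _ _ (wasserstein1_nonneg _ _) (wasserstein1_nonneg _ _) (wasserstein1_nonneg _ _)
      (wasserstein1_le_diam _ _) (wasserstein1_triangle _ _ _)
  intro μ₁ μ₂
  have h2 := key μ₁ μ₂
  have h3 := key μ₂ μ₁
  rw [wasserstein1_comm] at h3
  exact abs_le.2 ⟨by linarith, by linarith⟩

end MoreauYosida

/-! ### Scalar estimates and conclusion -/

/-- The convex function `t ^ α` lies above its tangent at `a`, whose slope is at most `α * D ^ (α -
1)`; the tangent bound is Bernoulli's inequality at `b / a - 1`. -/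
lemma rpow_le_rpow_add_mul {α a b w D : ℝ} (hα : 1 < α) (ha : 0 ≤ a) (hb : 0 ≤ b) (hw : 0 ≤ w)
    (haD : a ≤ D) (hab : a ≤ w + b) : a ^ α ≤ b ^ α + α * D ^ (α - 1) * w := by
  have hDα : a ^ (α - 1) ≤ D ^ (α - 1) := Real.rpow_le_rpow ha haD (by linarith)
  have hbα : 0 ≤ b ^ α := Real.rpow_nonneg hb α
  have haα : 0 ≤ a ^ (α - 1) := Real.rpow_nonneg ha _
  rcases ha.eq_or_lt with rfl | ha
  · rw [Real.zero_rpow (by linarith)]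
    have := haα.trans hDα
    positivity
  · have h1 := one_add_mul_self_le_rpow_one_add (s := b / a - 1)
      (by have : 0 ≤ b / a := by positivity
          linarith) hα.le
    rw [add_sub_cancel, Real.div_rpow hb ha.le, le_div_iff₀ (Real.rpow_pos_of_pos ha α)] at h1
    have h2 : a ^ α = a ^ (α - 1) * a := by
      rw [← Real.rpow_add_one ha.ne', sub_add_cancel]
    have h3 : (1 + α * (b / a - 1)) * a ^ α = a ^ α - α * (a ^ (α - 1) * (a - b)) := by
      rw [h2]
      field_simp
      ring
    have h4 : a ^ (α - 1) * (a - b) ≤ D ^ (α - 1) * w :=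
      (mul_le_mul_of_nonneg_left (by linarith) haα).trans (mul_le_mul_of_nonneg_right hDα hw)
    have h5 := mul_le_mul_of_nonneg_left h4 (zero_le_one.trans hα.le)
    rw [h3] at h1
    linarith

theorem mainTheorem6 {X : Type*} [MetricSpace X] [CompactSpace X] [MeasurableSpace X]
    [BorelSpace X] (φ : ℝ → EReal) (hφ_proper : IsProperFn φ) (hφ_convex : IsConvexFn φ)
    (hφ_lsc : LowerSemicontinuous φ) (ν : ProbabilityMeasure X) (α : ℝ) (hα : 0 < α) :
    (∀ (μ : ProbabilityMeasure X) (l : ℝ), 0 < l →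
      ∃ ξ : ProbabilityMeasure X,
        moreauYosidaObjective φ l α μ ν ξ = moreauYosidaDivergence φ l α μ ν) ∧
    (∀ μ : ProbabilityMeasure X,
      fDivergence φ μ ν = (⨆ (l : ℝ) (_ : 0 < l), moreauYosidaDivergence φ l α μ ν) ∧
      Tendsto (fun l : ℝ => moreauYosidaDivergence φ l α μ ν) atTop
        (𝓝 (fDivergence φ μ ν))) ∧
    (φ 1 < ⊤ → ∀ l : ℝ, 0 < l →
      (α < 1 → IsHolderW1 l α (fun μ => moreauYosidaDivergence φ l α μ ν)) ∧
      (α = 1 → IsHolderW1 l 1 (fun μ => moreauYosidaDivergence φ l α μ ν)) ∧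
      (1 < α → ∃ C : ℝ, 0 ≤ C ∧
        IsHolderW1 C 1 (fun μ => moreauYosidaDivergence φ l α μ ν))) := by
  refine ⟨fun μ l hl => exists_moreauYosidaObjective_eq hφ_proper hφ_convex hφ_lsc ν hα μ hl,
    fun μ => ⟨fDivergence_eq_iSup_moreauYosidaDivergence hφ_proper hφ_convex hφ_lsc ν μ hα,
      tendsto_moreauYosidaDivergence hφ_proper hφ_convex hφ_lsc ν μ hα⟩,
    fun h1 l hl => ⟨fun hα1 => ?_, fun hα1 => ?_, fun hα1 => ?_⟩⟩
  · refine isHolderW1_moreauYosidaDivergence hφ_proper hφ_convex hφ_lsc h1 ν hα hl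
      fun a b w ha hb hw _ hab => ?_
    -- For `α < 1` the power `t ^ α` is subadditive.
    have h2 := (Real.rpow_le_rpow ha hab hα.le).trans
      (Real.rpow_add_le_add_rpow hw hb hα.le hα1.le)
    linarith [mul_le_mul_of_nonneg_left h2 hl.le]
  · subst hα1
    refine isHolderW1_moreauYosidaDivergence hφ_proper hφ_convex hφ_lsc h1 ν hα hl
      fun a b w _ _ _ _ hab => ?_
    simp only [Real.rpow_one]
    linarith [mul_le_mul_of_nonneg_left hab hl.le]
  · have hD : 0 ≤ Metric.diam (Set.univ : Set X) := Metric.diam_nonneg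
    refine ⟨l * (α * Metric.diam (Set.univ : Set X) ^ (α - 1)), by positivity,
      isHolderW1_moreauYosidaDivergence hφ_proper hφ_convex hφ_lsc h1 ν hα hl
        fun a b w ha hb hw haD hab => ?_⟩
    have h2 := rpow_le_rpow_add_mul hα1 ha hb hw haD hab
    rw [Real.rpow_one]
    linarith [mul_le_mul_of_nonneg_left h2 hl.le]
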